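/- Let $F$ be a finite forest of order $n$ with no isolated vertex. A set $D\subseteq V(F)$ is a total dominating set of $F$ if every vertex of $F$ (including those in $D$) has a neighbor in $D$. Let $\gamma_t$ be the total domination number of $F$, that is, the minimum cardinality of a total dominating set of $F$, and let $\sharp\gamma_t(F)$ be the number of minimum total dominating sets of $F$, that is, of total dominating sets of cardinality $\gamma_t$. Then $$\sharp\gamma_t(F)\le (1+\sqrt 2)^{\,n-\gamma_t},$$ with equality if and only if every connected component of $F$ is (isomorphic to) the complete graph $K_2$. -/

import Mathlib

namespace SimpleGraph

variable {V : Type*}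

/-- `D` is a total dominating set of `G`: every vertex of `G` has a neighbor in `D`. -/
def IsTotalDominatingSet (G : SimpleGraph V) (D : Finset V) : Prop :=
  ∀ v : V, ∃ w ∈ D, G.Adj v w

/-- The total domination number `γ_t(G)`: the minimum cardinality of a total dominating set of `G`.
(If `G` is finite and has no isolated vertex, then the set of all vertices is totally dominating, so
that the infimum is an attained minimum.) -/
noncomputable def totalDominationNumber (G : SimpleGraph V) : ℕ :=
  sInf {k : ℕ | ∃ D : Finset V, G.IsTotalDominatingSet D ∧ D.card = k}

/-- `D` is a minimum total dominating set (a `γ_t`-set) of `G`: a total dominating set of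
cardinality `γ_t(G)`. -/
def IsMinimumTotalDominatingSet (G : SimpleGraph V) (D : Finset V) : Prop :=
  G.IsTotalDominatingSet D ∧ D.card = G.totalDominationNumber

/-- `♯γ_t(G)`: the number of minimum total dominating sets of a finite graph `G`. -/
noncomputable def numMinimumTotalDominatingSets (G : SimpleGraph V) : ℕ :=
  Set.ncard {D : Finset V | G.IsMinimumTotalDominatingSet D}

end SimpleGraph

/-!
Choose for each vertex of an open packing `P`, a set of vertices with pairwise disjoint
neighborhoods, a neighbor in a total dominating set `D`: these neighbors are distinct, so
`|P| ≤ |D|`. In a forest without isolated vertices, repeatedly taking a deepest vertex yields an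
open packing with `|P| = γ_t`, and then every minimum total dominating set consists of exactly one
neighbor of each `v ∈ P`. As the neighborhoods are disjoint, it follows that
`♯γ_t ≤ ∏ v ∈ P, deg v ≤ 2 ^ ∑ v ∈ P, (deg v - 1) ≤ 2 ^ (n - γ_t)`.
Since `2 < 1 + √2`, equality forces `γ_t = n`, that is, every vertex has a single neighbor.
-/

namespace TotalDomination

open SimpleGraph

variable {V : Type*} {G : SimpleGraph V}

section MinimumTotalDominatingSets

theorem totalDominationNumber_le_card {D : Finset V} (hD : G.IsTotalDominatingSet D) :
    G.totalDominationNumber ≤ D.card :=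
  Nat.sInf_le ⟨D, hD, rfl⟩

theorem exists_isMinimumTotalDominatingSet {D : Finset V} (hD : G.IsTotalDominatingSet D) :
    ∃ D', G.IsMinimumTotalDominatingSet D' :=
  Nat.sInf_mem (s := {k | ∃ D : Finset V, G.IsTotalDominatingSet D ∧ D.card = k}) ⟨_, D, hD, rfl⟩

theorem isTotalDominatingSet_univ [Fintype V] (hiso : ∀ v, ¬ G.IsIsolated v) :
    G.IsTotalDominatingSet Finset.univ := fun v =>
  let ⟨w, hvw⟩ := exists_adj_iff_not_isIsolated.2 (hiso v)
  ⟨w, Finset.mem_univ w, hvw⟩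

theorem numMinimumTotalDominatingSets_pos [Finite V] (hiso : ∀ v, ¬ G.IsIsolated v) :
    0 < G.numMinimumTotalDominatingSets := by
  cases nonempty_fintype V
  exact (Set.ncard_pos (Set.toFinite _)).2
    (exists_isMinimumTotalDominatingSet (isTotalDominatingSet_univ hiso))

variable [Fintype V]

theorem exists_adj_iff_eq_of_totalDominationNumber_eq_card (hiso : ∀ v, ¬ G.IsIsolated v)
    (hγ : G.totalDominationNumber = Fintype.card V) (v : V) : ∃ u, ∀ w, G.Adj u w ↔ w = v := by
  classical
  have not_dominating : ¬ G.IsTotalDominatingSet (Finset.univ.erase v) := fun hD =>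
    (Finset.card_erase_lt_of_mem (Finset.mem_univ v)).not_ge
      (hγ.symm.trans_le (totalDominationNumber_le_card hD))
  obtain ⟨u, hu⟩ : ∃ u, ∀ w, G.Adj u w → w = v := by
    simpa [IsTotalDominatingSet, not_imp_not] using not_dominating
  obtain ⟨w, huw⟩ := exists_adj_iff_not_isIsolated.2 (hiso u)
  exact ⟨u, fun x => ⟨hu x, fun hx => by rwa [hx, ← hu w huw]⟩⟩

theorem totalDominationNumber_eq_card_iff (hiso : ∀ v, ¬ G.IsIsolated v) :
    G.totalDominationNumber = Fintype.card V ↔ ∀ v, ∃! w, G.Adj v w := by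
  constructor
  · intro hγ
    choose f hf using exists_adj_iff_eq_of_totalDominationNumber_eq_card hiso hγ
    have f_injective : Function.Injective f := fun v w hvw =>
      (hf w v).1 (hvw ▸ (hf v v).2 rfl)
    intro u
    obtain ⟨v, rfl⟩ := Finite.surjective_of_injective f_injective u
    exact ⟨v, (hf v v).2 rfl, fun w => (hf v w).1⟩
  · intro h
    obtain ⟨D, hD, hDcard⟩ :=
      exists_isMinimumTotalDominatingSet (isTotalDominatingSet_univ hiso)
    have D_eq_univ : D = Finset.univ := Finset.eq_univ_iff_forall.2 fun v => by
      obtain ⟨w, hvw, -⟩ := h v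
      obtain ⟨x, hxD, hwx⟩ := hD w
      rwa [(h w).unique hvw.symm hwx]
    rw [← hDcard, D_eq_univ, Finset.card_univ]

end MinimumTotalDominatingSets

section OpenPacking

/-- An open packing of `G`: a set of vertices whose (open) neighborhoods are pairwise disjoint. Its
cardinality is a lower bound for the total domination number. -/
def IsOpenPacking (G : SimpleGraph V) (P : Finset V) : Prop :=
  (P : Set V).PairwiseDisjoint G.neighborSet

namespace IsOpenPacking

variable {P D : Finset V}

theorem injective_of_forall_adj (hP : IsOpenPacking G P) {f : P → V}
    (hf : ∀ v : P, G.Adj v (f v)) : Function.Injective f := fun v w hvw =>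
  Subtype.ext (hP.elim_set v.2 w.2 (f v) (hf v) (hvw ▸ hf w))

theorem exists_image_subset [DecidableEq V] (hP : IsOpenPacking G P)
    (hD : G.IsTotalDominatingSet D) :
    ∃ f : P → V, (∀ v : P, G.Adj v (f v)) ∧ Finset.univ.image f ⊆ D ∧
      (Finset.univ.image f).card = P.card := by
  choose f hfD hf using hD
  refine ⟨fun v => f v, fun v => hf v, Finset.image_subset_iff.2 fun v _ => hfD v, ?_⟩
  rw [Finset.card_image_of_injective _ (hP.injective_of_forall_adj fun v => hf v),
    Finset.card_univ, Fintype.card_coe]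

theorem card_le (hP : IsOpenPacking G P) (hD : G.IsTotalDominatingSet D) : P.card ≤ D.card := by
  classical
  obtain ⟨f, -, hfD, hcard⟩ := hP.exists_image_subset hD
  exact hcard ▸ Finset.card_le_card hfD

theorem numMinimumTotalDominatingSets_le_prod_degree [G.LocallyFinite] (hP : IsOpenPacking G P)
    (hcard : P.card = G.totalDominationNumber) :
    G.numMinimumTotalDominatingSets ≤ ∏ v ∈ P, G.degree v := by
  classical
  let choices : Finset (P → V) := Fintype.piFinset fun v => G.neighborFinset v
  have subset_image : {D | G.IsMinimumTotalDominatingSet D} ⊆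
      (choices.image fun f => Finset.univ.image f : Finset (Finset V)) := by
    rintro D ⟨hD, hDcard⟩
    obtain ⟨f, hf, hfD, hfcard⟩ := hP.exists_image_subset hD
    have image_eq : Finset.univ.image f = D :=
      Finset.eq_of_subset_of_card_le hfD (hDcard.trans (hcard.symm.trans hfcard.symm)).le
    exact Finset.mem_coe.2 (Finset.mem_image.2
      ⟨f, Fintype.mem_piFinset.2 fun v => (G.mem_neighborFinset v _).2 (hf v), image_eq⟩)
  calc G.numMinimumTotalDominatingSets
      ≤ (choices.image fun f => Finset.univ.image f).card := by
        rw [← Set.ncard_coe_finset]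
        exact Set.ncard_le_ncard subset_image (Finset.finite_toSet _)
    _ ≤ choices.card := Finset.card_image_le
    _ = ∏ v : P, G.degree v := Fintype.card_piFinset _
    _ = ∏ v ∈ P, G.degree v := Finset.prod_coe_sort P fun v => G.degree v

theorem sum_degree_le_card [Fintype V] [G.LocallyFinite] (hP : IsOpenPacking G P) :
    ∑ v ∈ P, G.degree v ≤ Fintype.card V := by
  classical
  have disjoint_neighborFinset : (P : Set V).PairwiseDisjoint fun v => G.neighborFinset v :=
    fun v hv w hw hvw => Set.disjoint_toFinset.2 (hP hv hw hvw)
  calc ∑ v ∈ P, G.degree v = (P.biUnion fun v => G.neighborFinset v).card :=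
        (Finset.card_biUnion disjoint_neighborFinset).symm
    _ ≤ Fintype.card V := Finset.card_le_univ _

end IsOpenPacking

theorem prod_le_two_pow_sum_sub_card {ι : Type*} (s : Finset ι) (d : ι → ℕ) :
    ∏ i ∈ s, d i ≤ 2 ^ (∑ i ∈ s, d i - s.card) := by
  by_cases hd : ∀ i ∈ s, 1 ≤ d i
  · calc ∏ i ∈ s, d i ≤ ∏ i ∈ s, 2 ^ (d i - 1) :=
          Finset.prod_le_prod' fun i _ => Nat.le_of_pred_lt Nat.lt_two_pow_self
      _ = 2 ^ ∑ i ∈ s, (d i - 1) := Finset.prod_pow_eq_pow_sum s _ 2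
      _ = 2 ^ (∑ i ∈ s, d i - s.card) := by
          rw [Finset.sum_tsub_distrib s hd, Finset.card_eq_sum_ones]
  · push Not at hd
    obtain ⟨i, hi, hdi⟩ := hd
    rw [Finset.prod_eq_zero hi (Nat.lt_one_iff.1 hdi)]
    exact Nat.zero_le _

theorem IsOpenPacking.numMinimumTotalDominatingSets_le_two_pow [Fintype V] {P : Finset V}
    (hP : IsOpenPacking G P) (hcard : P.card = G.totalDominationNumber) :
    G.numMinimumTotalDominatingSets ≤ 2 ^ (Fintype.card V - G.totalDominationNumber) := by
  classical
  calc G.numMinimumTotalDominatingSets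
      ≤ ∏ v ∈ P, G.degree v := hP.numMinimumTotalDominatingSets_le_prod_degree hcard
    _ ≤ 2 ^ (∑ v ∈ P, G.degree v - P.card) := prod_le_two_pow_sum_sub_card P _
    _ ≤ 2 ^ (Fintype.card V - P.card) :=
        Nat.pow_le_pow_right two_pos (Nat.sub_le_sub_right hP.sum_degree_le_card _)
    _ = 2 ^ (Fintype.card V - G.totalDominationNumber) := by rw [hcard]

end OpenPacking

section Forests

theorem eq_of_adj_of_dist_le (hG : G.IsAcyclic) {r v x y : V} (hrv : G.Reachable r v)
    (hvx : G.Adj v x) (hvy : G.Adj v y) (hx : G.dist r x ≤ G.dist r v)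
    (hy : G.dist r y ≤ G.dist r v) : x = y := by
  classical
  obtain ⟨p, hp, -⟩ := hrv.exists_path_of_dist
  have eq_penultimate : ∀ z, G.Adj v z → G.dist r z ≤ G.dist r v → z = p.penultimate := by
    intro z hvz hz
    obtain ⟨q, hq, hq_length⟩ := (hrv.trans hvz.reachable).exists_path_of_dist
    have v_notMem : v ∉ q.support := fun hv => by
      have h_length := q.length_takeUntil_lt_length hv hvz.ne
      have h_dist := dist_le (q.takeUntil v hv)
      omega
    exact hG.eq_penultimate_of_adj_end hp hvz
      (hG.mem_support_of_ne_mem_support_of_adj_of_isPath hp hq hvz v_notMem)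
  rw [eq_penultimate x hvx hx, eq_penultimate y hvy hy]

theorem exists_adj_forall_disjoint_neighborSet (hG : G.IsAcyclic) {S : Finset V}
    (hS : S.Nonempty) (hiso : ∀ v ∈ S, ¬ G.IsIsolated v) :
    ∃ v ∈ S, ∃ u, G.Adj v u ∧
      ∀ w ∈ S, ¬ G.Adj w u → Disjoint (G.neighborSet v) (G.neighborSet w) := by
  classical
  -- Root the component of some `r ∈ S` at `r`: `v` is a deepest vertex of `S` in it and `u` is the
  -- parent of `v`, or any neighbor if `v = r`.
  obtain ⟨r, hr⟩ := hS
  obtain ⟨v, hv, hmax⟩ := (S.filter (G.Reachable r)).exists_max_image (G.dist r)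
    ⟨r, Finset.mem_filter.2 ⟨hr, Reachable.rfl⟩⟩
  obtain ⟨hvS, hrv⟩ := Finset.mem_filter.1 hv
  obtain ⟨u, hvu, parent_unique⟩ : ∃ u, G.Adj v u ∧
      ∀ x, G.Adj v x → G.dist r x ≤ G.dist r v → x = u := by
    by_cases hparent : ∃ u, G.Adj v u ∧ G.dist r u ≤ G.dist r v
    · obtain ⟨u, hvu, hu⟩ := hparent
      exact ⟨u, hvu, fun x hvx hx => eq_of_adj_of_dist_le hG hrv hvx hvu hx hu⟩
    · obtain ⟨u, hvu⟩ := exists_adj_iff_not_isIsolated.2 (hiso v hvS)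
      exact ⟨u, hvu, fun x hvx hx => (hparent ⟨x, hvx, hx⟩).elim⟩
  refine ⟨v, hvS, u, hvu, fun w hwS hwu => Set.disjoint_left.2 fun x hvx hwx => hwu ?_⟩
  rw [mem_neighborSet] at hvx hwx
  by_cases hx : G.dist r x ≤ G.dist r v
  · exact parent_unique x hvx hx ▸ hwx
  -- A child `x` of `v` has no other neighbor in `S`, since no vertex of `S` is deeper than `v`.
  · have hrx : G.Reachable r x := hrv.trans hvx.reachable
    have hw : G.dist r w ≤ G.dist r v :=
      hmax w (Finset.mem_filter.2 ⟨hwS, hrx.trans hwx.symm.reachable⟩)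
    have hwv : w = v :=
      eq_of_adj_of_dist_le hG hrx hwx.symm hvx.symm (by omega) (by omega)
    exact hwv ▸ hvu

theorem exists_isOpenPacking_card_ge (hG : G.IsAcyclic) (S : Finset V)
    (hiso : ∀ v ∈ S, ¬ G.IsIsolated v) :
    ∃ D P : Finset V, (∀ v ∈ S, ∃ w ∈ D, G.Adj v w) ∧ P ⊆ S ∧ IsOpenPacking G P ∧
      D.card ≤ P.card := by
  classical
  induction S using Finset.strongInduction with
  | H S ih =>
    obtain rfl | hS := S.eq_empty_or_nonempty
    · exact ⟨∅, ∅, by simp, subset_rfl, by simp [IsOpenPacking], le_rfl⟩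
    obtain ⟨v, hvS, u, hvu, hdisjoint⟩ := exists_adj_forall_disjoint_neighborSet hG hS hiso
    obtain ⟨D, P, hD, hPS, hP, hcard⟩ := ih (S.filter fun w => ¬ G.Adj w u)
      (Finset.filter_ssubset.2 ⟨v, hvS, not_not.2 hvu⟩)
      fun w hw => hiso w (Finset.mem_filter.1 hw).1
    have hP_mem : ∀ w ∈ P, w ∈ S ∧ ¬ G.Adj w u := fun w hw => Finset.mem_filter.1 (hPS hw)
    refine ⟨insert u D, insert v P, fun w hwS => ?_, ?_, ?_, ?_⟩
    · by_cases hwu : G.Adj w u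
      · exact ⟨u, Finset.mem_insert_self u D, hwu⟩
      · obtain ⟨x, hxD, hwx⟩ := hD w (Finset.mem_filter.2 ⟨hwS, hwu⟩)
        exact ⟨x, Finset.mem_insert_of_mem hxD, hwx⟩
    · exact Finset.insert_subset hvS fun w hw => (hP_mem w hw).1
    · rw [IsOpenPacking, Finset.coe_insert]
      exact hP.insert fun w hw _ => hdisjoint w (hP_mem w hw).1 (hP_mem w hw).2
    · have hvP : v ∉ P := fun hv => (hP_mem v hv).2 hvu
      rw [Finset.card_insert_of_notMem hvP]
      exact (Finset.card_insert_le u D).trans (Nat.succ_le_succ hcard)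

theorem exists_isOpenPacking_card_eq [Finite V] (hG : G.IsAcyclic)
    (hiso : ∀ v, ¬ G.IsIsolated v) :
    ∃ P, IsOpenPacking G P ∧ P.card = G.totalDominationNumber := by
  cases nonempty_fintype V
  obtain ⟨D, P, hD, -, hP, hcard⟩ :=
    exists_isOpenPacking_card_ge hG Finset.univ fun v _ => hiso v
  have hD' : G.IsTotalDominatingSet D := fun v => hD v (Finset.mem_univ v)
  obtain ⟨D₀, hD₀, hD₀_card⟩ := exists_isMinimumTotalDominatingSet hD'
  exact ⟨P, hP, (hD₀_card ▸ hP.card_le hD₀).antisymm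
    ((totalDominationNumber_le_card hD').trans hcard)⟩

end Forests

section CompleteComponents

theorem eq_or_eq_of_reachable (h : ∀ v, ∃! w, G.Adj v w) {v w x : V} (hvw : G.Adj v w)
    (hvx : G.Reachable v x) : x = v ∨ x = w := by
  rw [reachable_iff_reflTransGen] at hvx
  induction hvx with
  | refl => exact .inl rfl
  | tail _ hadj ih =>
    rcases ih with rfl | rfl
    · exact .inr ((h _).unique hadj hvw)
    · exact .inl ((h _).unique hadj hvw.symm)

theorem nonempty_iso_top_fin_two_iff (hG : G.Connected) :
    Nonempty (G ≃g (⊤ : SimpleGraph (Fin 2))) ↔ ∀ v, ∃! w, G.Adj v w := by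
  constructor
  · rintro ⟨e⟩ v
    have existsUnique_ne : ∀ i : Fin 2, ∃! j, i ≠ j := by
      unfold ExistsUnique
      decide
    exact (e.toEquiv.existsUnique_congr fun _ => e.map_adj_iff.symm).2 (existsUnique_ne (e v))
  · intro h
    obtain ⟨v⟩ := hG.nonempty
    obtain ⟨w, hvw, -⟩ := h v
    have eq_or_eq : ∀ x, x = v ∨ x = w := fun x => eq_or_eq_of_reachable h hvw (hG v x)
    have G_eq_top : G = ⊤ := eq_top_iff_forall_ne_adj.2 fun x y hxy => by
      rcases eq_or_eq x with rfl | rfl <;> rcases eq_or_eq y with rfl | rfl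
      exacts [(hxy rfl).elim, hvw, hvw.symm, (hxy rfl).elim]
    have card_eq_two : Nat.card V = 2 :=
      Nat.card_eq_two_iff.2 ⟨v, w, hvw.ne, Set.eq_univ_of_forall eq_or_eq⟩
    have : Finite V := Nat.finite_of_card_ne_zero (by omega)
    rw [G_eq_top]
    exact ⟨Iso.completeGraph (Finite.equivFinOfCardEq card_eq_two)⟩

theorem existsUnique_toSimpleGraph_adj_iff (C : G.ConnectedComponent) (v : C) :
    (∃! w, C.toSimpleGraph.Adj v w) ↔ ∃! w, G.Adj v w := by
  constructor
  · rintro ⟨w, hvw, hw⟩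
    exact ⟨w, hvw, fun x hvx =>
      congrArg Subtype.val (hw ⟨x, C.mem_supp_of_adj_mem_supp v.2 hvx⟩ hvx)⟩
  · rintro ⟨w, hvw, hw⟩
    exact ⟨⟨w, C.mem_supp_of_adj_mem_supp v.2 hvw⟩, hvw, fun x hvx => Subtype.ext (hw x hvx)⟩

theorem forall_nonempty_iso_top_fin_two_iff :
    (∀ C : G.ConnectedComponent, Nonempty (C.toSimpleGraph ≃g (⊤ : SimpleGraph (Fin 2)))) ↔
      ∀ v, ∃! w, G.Adj v w := by
  simp only [fun C : G.ConnectedComponent => nonempty_iso_top_fin_two_iff C.connected_toSimpleGraph,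
    existsUnique_toSimpleGraph_adj_iff]
  exact ⟨fun h v => h (G.connectedComponentMk v) ⟨v, rfl⟩, fun h _ v => h v⟩

end CompleteComponents

theorem two_lt_one_add_sqrt_two : (2 : ℝ) < 1 + Real.sqrt 2 := by
  have one_lt_sqrt_two : (1 : ℝ) < Real.sqrt 2 := Real.lt_sqrt_of_sq_lt (by norm_num)
  linarith

end TotalDomination

open TotalDomination in
theorem theorem1p3_general {V : Type*} [Fintype V] {G : SimpleGraph V} {b : ℝ} (hb : 2 < b)
    {P : Finset V} (hP : IsOpenPacking G P) (hcard : P.card = G.totalDominationNumber)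
    (hiso : ∀ v, ¬ G.IsIsolated v) :
    (G.numMinimumTotalDominatingSets : ℝ) ≤
        b ^ ((Fintype.card V : ℤ) - (G.totalDominationNumber : ℤ)) ∧
      ((G.numMinimumTotalDominatingSets : ℝ) =
          b ^ ((Fintype.card V : ℤ) - (G.totalDominationNumber : ℤ)) ↔
        ∀ C : G.ConnectedComponent,
          Nonempty (C.toSimpleGraph ≃g (⊤ : SimpleGraph (Fin 2)))) := by
  have hγ : G.totalDominationNumber ≤ Fintype.card V :=
    totalDominationNumber_le_card (isTotalDominatingSet_univ hiso)
  have hnum : (G.numMinimumTotalDominatingSets : ℝ) ≤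
      2 ^ (Fintype.card V - G.totalDominationNumber) :=
    mod_cast hP.numMinimumTotalDominatingSets_le_two_pow hcard
  rw [forall_nonempty_iso_top_fin_two_iff, ← totalDominationNumber_eq_card_iff hiso,
    ← Nat.cast_sub hγ, zpow_natCast]
  refine ⟨hnum.trans (pow_le_pow_left₀ two_pos.le hb.le _), fun heq => ?_, fun heq => ?_⟩
  · by_contra hne
    exact (heq ▸ hnum).not_gt (pow_lt_pow_left₀ hb two_pos.le (by omega))
  · have one_le_num : (1 : ℝ) ≤ G.numMinimumTotalDominatingSets :=
      mod_cast numMinimumTotalDominatingSets_pos hiso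
    rw [heq, Nat.sub_self, pow_zero] at hnum ⊢
    exact hnum.antisymm one_le_num

theorem theorem1p3 {V : Type*} [Fintype V] (F : SimpleGraph V)
    (hforest : F.IsAcyclic) (hiso : ∀ v : V, ¬ F.IsIsolated v) :
    (F.numMinimumTotalDominatingSets : ℝ) ≤
        (1 + Real.sqrt 2) ^ ((Fintype.card V : ℤ) - (F.totalDominationNumber : ℤ)) ∧
      ((F.numMinimumTotalDominatingSets : ℝ) =
          (1 + Real.sqrt 2) ^ ((Fintype.card V : ℤ) - (F.totalDominationNumber : ℤ)) ↔
        ∀ C : F.ConnectedComponent,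
          Nonempty (C.toSimpleGraph ≃g (⊤ : SimpleGraph (Fin 2)))) := by
  obtain ⟨P, hP, hcard⟩ := TotalDomination.exists_isOpenPacking_card_eq hforest hiso
  exact theorem1p3_general TotalDomination.two_lt_one_add_sqrt_two hP hcard hiso
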